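/- Fix a first-order signature $\sigma$. Individual variables come from a countable set, all models $\mathfrak M$ are nonempty, and a team $X$ over $\mathfrak M$ with domain $\mathrm{dom}(X)$ (a set of variables) is a set of assignments $s\colon \mathrm{dom}(X)\to M$. Formulas are in negation normal form and are interpreted in (lax) team semantics: $\mathfrak M\models_X\alpha$ for a first-order literal $\alpha$ iff every $s\in X$ satisfies $\alpha$; $\mathfrak M\models_X\psi_1\wedge\psi_2$ iff $\mathfrak M\models_X\psi_1$ and $\mathfrak M\models_X\psi_2$; $\mathfrak M\models_X\psi_1\vee\psi_2$ iff $X=Y\cup Z$ for some $Y,Z$ with $\mathfrak M\models_Y\psi_1$ and $\mathfrak M\models_Z\psi_2$; $\mathfrak M\models_X\exists v\,\psi$ iff there is $H\colon X\to\mathcal P(M)\setminus\{\varnothing\}$ such that $\mathfrak M\models_{X'}\psi$ for $X'=\{s[m/v] : s\in X,\ m\in H(s)\}$; $\mathfrak M\models_X\forall v\,\psi$ iff $\mathfrak M\models_{X'}\psi$ for $X'=\{s[m/v] : s\in X,\ m\in M\}$. For tuples of terms $\vec t_1,\vec t_2$ and a term $t$, and tuples of every length $k\ge 0$: - dependence atom: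 $\mathfrak M\models_X\,=\!(\vec t_1,t)$ iff for all $s,s'\in X$, $s(\vec t_1)=s'(\vec t_1)$ implies $s(t)=s'(t)$; - exclusion atom (where $\vec t_1,\vec t_2$ have the same length): $\mathfrak M\models_X\vec t_1\mid\vec t_2$ iff $s(\vec t_1)\ne s'(\vec t_2)$ for all $s,s'\in X$; - flattening operator: $\mathfrak M\models_X\mathsf F\varphi$ iff $\mathfrak M\models_{\{s\}}\varphi$ for all $s\in X$. $\mathrm{FO}(\mathcal D)$ denotes the extension of first-order logic by the constructors in $\mathcal D$; so $\mathrm{FO}(=\!(\dots))$ is dependence logic and $\mathrm{FO}(\mid)$ is exclusion logic. $\mathrm{ESO}$ denotes existential second-order logic (a block of existential quantifiers over relations of arbitrary finite arities, followed by a first-order formula). For variables $\vec x=(x_1,\dots,x_n)$ in $\mathrm{dom}(X)$ put $X(\vec x)=\{(s(x_1),\dots,s(x_n)) : s\in X\}\subseteq M^n$. **Theorem.** 1. For every $\mathrm{FO}(=\!(\dots),\mathsf F)$-formula $\varphi$ over $\sigma$ with free variables among $\vec x=(x_1,\dots,x_n)$ there is an $\mathrm{ESO}$-formula $\varphi^*(R)$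 over $\sigma$ with one free relation variable $R$, of arity $n$, and no free individual variables, which is downwards closed (i.e. $\langle\mathfrak M,A\rangle\models\varphi^*(R)$ and $A'\subseteq A$ imply $\langle\mathfrak M,A'\rangle\models\varphi^*(R)$), such that for all models $\mathfrak M$ and all teams $X$ over $\mathfrak M$ with $\mathrm{dom}(X)\supseteq\{x_1,\dots,x_n\}$, $$\mathfrak M\models_X\varphi\quad\Longleftrightarrow\quad\langle\mathfrak M,R:=X(\vec x)\rangle\models\varphi^*(R)\vee\forall\vec x\,\neg R(\vec x).$$ 2. The operator $\mathsf F$ does not increase the expressive power of dependence logic: $\mathrm{FO}(=\!(\dots),\mathsf F)\equiv\mathrm{FO}(=\!(\dots))$. 3. The operator $\mathsf F$ does not increase the expressive power of exclusion logic: $\mathrm{FO}(\mid,\mathsf F)\equiv\mathrm{FO}(\mid)$. Here $\mathcal L_1\equiv\mathcal L_2$ means that for every formula $\varphi$ of one of the two logics there is a formula $\psi$ of the other, with $\mathrm{FV}(\psi)\subseteq\mathrm{FV}(\varphi)$, such that $\mathfrak M\models_X\varphi\iff\mathfrak M\models_X\psi$ for all models $\mathfrak M$ and all teams $X$ with $\mathrm{dom}(X)\supseteq\mathrm{FV}(\varphi)$.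 -/

import Mathlib

universe u v w


namespace TeamLogic

open FirstOrder

/-- The countable set of individual variable symbols. -/
abbrev Var : Type := ℕ

/-! ### Syntax -/

/-- Names of the constructors that may be added to first-order logic. -/
inductive Constructor : Type
  | dep
  | excl
  | flat

/-- Team-based formulas, in negation normal form, over the signature `L`: first-order literals,
connectives and quantifiers, dependence atoms `=(t₁, t₂)`, exclusion atoms `t₁ | t₂` (of all
arities, including `0`), and the flattening operator `F`. -/
inductive Formula (L : FirstOrder.Language.{u, v}) : Type (max u v)
  | eq (t₁ t₂ : L.Term Var) : Formula L
  | ne (t₁ t₂ : L.Term Var) : Formula L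
  | rel {k : ℕ} (R : L.Relations k) (ts : Fin k → L.Term Var) : Formula L
  | nrel {k : ℕ} (R : L.Relations k) (ts : Fin k → L.Term Var) : Formula L
  | dep {k : ℕ} (ts : Fin k → L.Term Var) (t : L.Term Var) : Formula L
  | excl {k : ℕ} (ts₁ ts₂ : Fin k → L.Term Var) : Formula L
  | or (φ ψ : Formula L) : Formula L
  | and (φ ψ : Formula L) : Formula L
  | ex (x : Var) (φ : Formula L) : Formula L
  | all (x : Var) (φ : Formula L) : Formula L
  | flat (φ : Formula L) : Formula L

/-- The variables occurring in a tuple of terms. -/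
def tupleVars {L : FirstOrder.Language.{u, v}} {k : ℕ} (ts : Fin k → L.Term Var) : Finset Var :=
  Finset.univ.biUnion fun i => (ts i).varFinset

/-- The free variables of a formula. -/
def Formula.FV {L : FirstOrder.Language.{u, v}} : Formula L → Finset Var
  | .eq t₁ t₂ => t₁.varFinset ∪ t₂.varFinset
  | .ne t₁ t₂ => t₁.varFinset ∪ t₂.varFinset
  | .rel _ ts => tupleVars ts
  | .nrel _ ts => tupleVars ts
  | .dep ts t => tupleVars ts ∪ t.varFinset
  | .excl ts₁ ts₂ => tupleVars ts₁ ∪ tupleVars ts₂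
  | .or φ ψ => φ.FV ∪ ψ.FV
  | .and φ ψ => φ.FV ∪ ψ.FV
  | .ex x φ => φ.FV.erase x
  | .all x φ => φ.FV.erase x
  | .flat φ => φ.FV

/-- `φ.InLogic 𝒟` says that `φ` is a formula of `FO(𝒟)`, that is, beyond first-order logic it uses
only the constructors in `𝒟`. -/
def Formula.InLogic {L : FirstOrder.Language.{u, v}} (𝒟 : Set Constructor) : Formula L → Prop
  | .eq _ _ => True
  | .ne _ _ => True
  | .rel _ _ => True
  | .nrel _ _ => True
  | .dep _ _ => Constructor.dep ∈ 𝒟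
  | .excl _ _ => Constructor.excl ∈ 𝒟
  | .or φ ψ => φ.InLogic 𝒟 ∧ ψ.InLogic 𝒟
  | .and φ ψ => φ.InLogic 𝒟 ∧ ψ.InLogic 𝒟
  | .ex _ φ => φ.InLogic 𝒟
  | .all _ φ => φ.InLogic 𝒟
  | .flat φ => Constructor.flat ∈ 𝒟 ∧ φ.InLogic 𝒟

/-! ### Team semantics

An assignment with domain `D` is a function `D → M`; a team with domain `D` is a set of these. -/

section Semantics

variable {M : Type w} {D : Set Var}

open Classical in
/-- A total extension of an assignment, needed to apply `Term.realize`. The values outside `D` do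
not matter for terms whose variables lie in `D`, and only these are ever considered. -/
noncomputable def extend [Nonempty M] (s : D → M) : Var → M :=
  fun i => if h : i ∈ D then s ⟨i, h⟩ else Classical.arbitrary M

/-- The value `s(t)` of a term under an assignment. -/
noncomputable def val {L : FirstOrder.Language.{u, v}} [L.Structure M] [Nonempty M] (s : D → M)
    (t : L.Term Var) : M :=
  t.realize (extend s)

open Classical in
/-- The assignment `s[m/x]`, with domain `D ∪ {x}`. -/
noncomputable def update (s : D → M) (x : Var) (m : M) : ↥(insert x D : Set Var) → M :=
  fun i => if h : i.1 = x then m else s ⟨i.1, i.2.resolve_left h⟩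

/-- The supplementation `X[H/x]`. -/
def supplement (X : Set (D → M)) (x : Var) (H : X → Set M) :
    Set (↥(insert x D : Set Var) → M) :=
  {s' | ∃ s : X, ∃ m ∈ H s, s' = update s.1 x m}

/-- The duplication `X[M/x]`. -/
def duplicate (X : Set (D → M)) (x : Var) : Set (↥(insert x D : Set Var) → M) :=
  {s' | ∃ s ∈ X, ∃ m : M, s' = update s x m}

/-- The relation `X(x₁, …, xₙ) = {(s(x₁), …, s(xₙ)) | s ∈ X}`. -/
def teamRel (X : Set (D → M)) {n : ℕ} (x : Fin n → Var) (hx : ∀ i, x i ∈ D) :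
    Set (Fin n → M) :=
  {a | ∃ s ∈ X, a = fun i => s ⟨x i, hx i⟩}

end Semantics

/-- Lax team semantics: `Sat M φ D X` says that the model `M` and the team `X` with domain `D`
satisfy `φ`. It is meaningful when `φ.FV ⊆ D`. -/
def Sat {L : FirstOrder.Language.{u, v}} (M : Type w) [L.Structure M] [Nonempty M] :
    Formula L → (D : Set Var) → Set (D → M) → Prop
  | .eq t₁ t₂, _, X => ∀ s ∈ X, val s t₁ = val s t₂
  | .ne t₁ t₂, _, X => ∀ s ∈ X, val s t₁ ≠ val s t₂
  | .rel R ts, _, X => ∀ s ∈ X, FirstOrder.Language.Structure.RelMap R fun i => val s (ts i)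
  | .nrel R ts, _, X => ∀ s ∈ X, ¬ FirstOrder.Language.Structure.RelMap R fun i => val s (ts i)
  | .dep ts t, _, X =>
      ∀ s ∈ X, ∀ s' ∈ X, (∀ i, val s (ts i) = val s' (ts i)) → val s t = val s' t
  | .excl ts₁ ts₂, _, X =>
      ∀ s ∈ X, ∀ s' ∈ X, (fun i => val s (ts₁ i)) ≠ fun i => val s' (ts₂ i)
  | .or φ ψ, D, X => ∃ Y Z : Set (D → M), X = Y ∪ Z ∧ Sat M φ D Y ∧ Sat M ψ D Z
  | .and φ ψ, D, X => Sat M φ D X ∧ Sat M ψ D X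
  | .ex x φ, D, X =>
      ∃ H : X → Set M, (∀ s, (H s).Nonempty) ∧ Sat M φ (insert x D) (supplement X x H)
  | .all x φ, D, X => Sat M φ (insert x D) (duplicate X x)
  | .flat φ, D, X => ∀ s ∈ X, Sat M φ D {s}

/-! ### Expressive power -/

/-- `φ` and `ψ` are satisfied by the same nonempty models and teams (in the universe `w`), for all
teams whose domain contains the free variables of both. -/
def Equivalent {L : FirstOrder.Language.{u, v}} (φ ψ : Formula L) : Prop :=
  ∀ (M : Type w) [L.Structure M] [Nonempty M] (D : Set Var) (X : Set (D → M)),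
    (φ.FV : Set Var) ⊆ D → (ψ.FV : Set Var) ⊆ D → (Sat M φ D X ↔ Sat M ψ D X)

/-- Every formula of `FO(𝒟₁)` over `L` is equivalent to a formula of `FO(𝒟₂)` over `L` that has no
further free variables; in particular sentences go to sentences. -/
def ExpressibleIn (L : FirstOrder.Language.{u, v}) (𝒟₁ 𝒟₂ : Set Constructor) : Prop :=
  ∀ φ : Formula L, φ.InLogic 𝒟₁ →
    ∃ ψ : Formula L, ψ.InLogic 𝒟₂ ∧ ψ.FV ⊆ φ.FV ∧ Equivalent.{u, v, w} φ ψ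

/-- `FO(𝒟₁)` and `FO(𝒟₂)` have the same expressive power. -/
def SameExpressivePower (L : FirstOrder.Language.{u, v}) (𝒟₁ 𝒟₂ : Set Constructor) : Prop :=
  ExpressibleIn.{u, v, w} L 𝒟₁ 𝒟₂ ∧ ExpressibleIn.{u, v, w} L 𝒟₂ 𝒟₁

/-! ### Existential second-order logic -/

/-- The language with one relation symbol of arity `ar i` for each `i`, and nothing else. -/
def relLang {m : ℕ} (ar : Fin m → ℕ) : FirstOrder.Language.{0, 0} where
  Functions _ := Empty
  Relations k := {i : Fin m // ar i = k}

/-- The interpretation of these relation symbols by given relations. -/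
@[reducible] def relStructure {m : ℕ} (ar : Fin m → ℕ) {M : Type w}
    (A : ∀ i, Set (Fin (ar i) → M)) : (relLang ar).Structure M where
  funMap f := f.elim
  RelMap R a := (fun j => a (Fin.cast R.2 j)) ∈ A R.1

/-- An `ESO`-sentence over `L`: `∃ S₁ … ∃ Sₘ θ`, where the `Sᵢ` are relation variables
of given arities and `θ` is a first-order sentence over `L ∪ {S₁, …, Sₘ}`. -/
structure ESOSentence (L : FirstOrder.Language.{u, v}) : Type (max u v) where
  m : ℕ
  ar : Fin m → ℕ
  matrix : (L.sum (relLang ar)).Sentence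

/-- Truth of an `ESO`-sentence in a model. -/
def ESOSentence.Realize {L : FirstOrder.Language.{u, v}} (θ : ESOSentence L) (M : Type w) [L.Structure M] :
    Prop :=
  ∃ S : ∀ i, Set (Fin (θ.ar i) → M),
    letI := relStructure θ.ar S
    M ⊨ θ.matrix

/-- An `ESO`-formula `θ(R)` over `L` with one free relation variable `R` of arity `n`: an
`ESO`-sentence over `L ∪ {R}`. -/
abbrev ESOFormula (L : FirstOrder.Language.{u, v}) (n : ℕ) : Type (max u v) :=
  ESOSentence (L.sum (relLang fun _ : Fin 1 => n))

/-- `⟨M, R := A⟩ ⊨ θ(R)`. -/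
def ESOFormula.Realize {L : FirstOrder.Language.{u, v}} {n : ℕ} (θ : ESOFormula L n) (M : Type w)
    [L.Structure M] (A : Set (Fin n → M)) : Prop :=
  letI := relStructure (fun _ : Fin 1 => n) fun _ => A
  ESOSentence.Realize θ M

/-- `θ(R)` is downwards closed: `⟨M, A⟩ ⊨ θ(R)` and `A' ⊆ A` imply `⟨M, A'⟩ ⊨ θ(R)`. -/
def ESOFormula.DownwardsClosed {L : FirstOrder.Language.{u, v}} {n : ℕ} (θ : ESOFormula L n) : Prop :=
  ∀ (M : Type w) [L.Structure M] [Nonempty M] (A A' : Set (Fin n → M)),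
    A' ⊆ A → ESOFormula.Realize θ M A → ESOFormula.Realize θ M A'

end TeamLogic

universe u' v'

namespace TeamLogic

open FirstOrder

variable {L : FirstOrder.Language.{u, v}} {M : Type w}

/-! ### Team semantics over total assignments -/

/-! Everything rests on locality and downwards closure (`TSat.of_eqOn`), which allow the covering
and quantifier clauses to be read as inclusions.

Flattening is eliminated by the same construction for both kinds of atoms. Prefix variables `ys`,
which do not occur in `φ`, to each atom, on both sides of an exclusion atom. Pairs of assignments
that differ on `ys` then satisfy the atom trivially, and the connectives and quantifiers act
separately on each part where `ys` is constant. So the guarded formula says that `φ` holds on every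
such part (`tSat_guard_iff`). If `ys` are copies of the free variables of `φ`, introduced by
existential quantifiers and equations, each part amounts by locality to a single assignment, and the
result expresses `F φ` (`tSat_flatten_iff`). Working from the inside out removes every `F`.

For the first claim, remove `F` and then guess the teams of all subformula occurrences at once, as
relations. Their compatibility is first-order (`exists_isLabelling_iff`,
`exists_sentence_isLabelling`). `R` enters only through a lower bound on the team at the root, so
downwards closure passes from `φ` to the translation. The extra disjunct is harmless because the
empty team satisfies every formula. -/

theorem realize_congr [L.Structure M] (t : L.Term Var) {s s' : Var → M}
    (h : Set.EqOn s s' t.varFinset) : t.realize s = t.realize s' := by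
  induction t with
  | var i => exact h (by simp [Language.Term.varFinset])
  | func f ts ih =>
    simp only [Language.Term.realize]
    congr 1
    funext i
    exact ih i (h.mono fun x hx => by
      simpa [Language.Term.varFinset] using ⟨i, hx⟩)

theorem eqOn_of_tupleVars {k : ℕ} {ts : Fin k → L.Term Var} {s s' : Var → M}
    (h : Set.EqOn s s' (tupleVars ts)) (i : Fin k) : Set.EqOn s s' (ts i).varFinset :=
  h.mono fun x hx => by simpa [tupleVars] using ⟨i, hx⟩

/-- Team semantics for teams of total assignments. The clauses for disjunctions and quantifiers
are relaxed from equalities to inclusions, which makes no difference as all formulas are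
downwards closed. -/
def TSat (M : Type w) [L.Structure M] : Formula L → Set (Var → M) → Prop
  | .eq t₁ t₂, X => ∀ s ∈ X, t₁.realize s = t₂.realize s
  | .ne t₁ t₂, X => ∀ s ∈ X, t₁.realize s ≠ t₂.realize s
  | .rel R ts, X => ∀ s ∈ X, Language.Structure.RelMap R fun i => (ts i).realize s
  | .nrel R ts, X => ∀ s ∈ X, ¬ Language.Structure.RelMap R fun i => (ts i).realize s
  | .dep ts t, X =>
      ∀ s ∈ X, ∀ s' ∈ X, (∀ i, (ts i).realize s = (ts i).realize s') → t.realize s = t.realize s'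
  | .excl ts₁ ts₂, X =>
      ∀ s ∈ X, ∀ s' ∈ X, ¬ ∀ i, (ts₁ i).realize s = (ts₂ i).realize s'
  | .or φ ψ, X => ∃ Y Z, X ⊆ Y ∪ Z ∧ TSat M φ Y ∧ TSat M ψ Z
  | .and φ ψ, X => TSat M φ X ∧ TSat M ψ X
  | .ex x φ, X => ∃ Y, (∀ s ∈ X, ∃ m, Function.update s x m ∈ Y) ∧ TSat M φ Y
  | .all x φ, X => ∃ Y, (∀ s ∈ X, ∀ m, Function.update s x m ∈ Y) ∧ TSat M φ Y
  | .flat φ, X => ∀ s ∈ X, TSat M φ {s}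

theorem eqOn_update_of_erase {V : Finset Var} {x : Var} {s s' : Var → M}
    (h : Set.EqOn s s' (V.erase x)) (m : M) :
    Set.EqOn (Function.update s x m) (Function.update s' x m) V := by
  intro y hy
  rcases eq_or_ne y x with rfl | hne
  · simp
  · simpa [hne] using h (by simpa [hne] using hy)

/-- Locality and downwards closure. -/
theorem TSat.of_eqOn [L.Structure M] {φ : Formula L} {X X' : Set (Var → M)}
    (hX : TSat M φ X) (h : ∀ s' ∈ X', ∃ s ∈ X, Set.EqOn s' s φ.FV) : TSat M φ X' := by
  induction φ generalizing X X' with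
  | eq t₁ t₂ =>
    intro s' hs'
    obtain ⟨s, hs, he⟩ := h s' hs'
    simp only [Formula.FV, Finset.coe_union, Set.eqOn_union] at he
    rw [realize_congr t₁ he.1, realize_congr t₂ he.2]
    exact hX s hs
  | ne t₁ t₂ =>
    intro s' hs'
    obtain ⟨s, hs, he⟩ := h s' hs'
    simp only [Formula.FV, Finset.coe_union, Set.eqOn_union] at he
    rw [realize_congr t₁ he.1, realize_congr t₂ he.2]
    exact hX s hs
  | rel R ts =>
    intro s' hs'
    obtain ⟨s, hs, he⟩ := h s' hs'
    simp only [fun i => realize_congr (ts i) (eqOn_of_tupleVars he i)]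
    exact hX s hs
  | nrel R ts =>
    intro s' hs'
    obtain ⟨s, hs, he⟩ := h s' hs'
    simp only [fun i => realize_congr (ts i) (eqOn_of_tupleVars he i)]
    exact hX s hs
  | dep ts t =>
    intro s' hs' r' hr'
    obtain ⟨s, hs, he⟩ := h s' hs'
    obtain ⟨r, hr, hf⟩ := h r' hr'
    simp only [Formula.FV, Finset.coe_union, Set.eqOn_union] at he hf
    simp only [fun i => realize_congr (ts i) (eqOn_of_tupleVars he.1 i),
      fun i => realize_congr (ts i) (eqOn_of_tupleVars hf.1 i),
      realize_congr t he.2, realize_congr t hf.2]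
    exact hX s hs r hr
  | excl ts₁ ts₂ =>
    intro s' hs' r' hr'
    obtain ⟨s, hs, he⟩ := h s' hs'
    obtain ⟨r, hr, hf⟩ := h r' hr'
    simp only [Formula.FV, Finset.coe_union, Set.eqOn_union] at he hf
    simp only [fun i => realize_congr (ts₁ i) (eqOn_of_tupleVars he.1 i),
      fun i => realize_congr (ts₂ i) (eqOn_of_tupleVars hf.2 i)]
    exact hX s hs r hr
  | or φ ψ ihφ ihψ =>
    obtain ⟨Y, Z, hYZ, hY, hZ⟩ := hX
    simp only [Formula.FV, Finset.coe_union, Set.eqOn_union] at h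
    -- The witnesses are saturated under agreement on the free variables; the covering clause
    -- permits them to exceed the team.
    refine ⟨{s' | ∃ s ∈ Y, Set.EqOn s' s φ.FV}, {s' | ∃ s ∈ Z, Set.EqOn s' s ψ.FV}, ?_,
      ihφ hY fun _ hs => hs, ihψ hZ fun _ hs => hs⟩
    intro s' hs'
    obtain ⟨s, hs, he⟩ := h s' hs'
    exact (hYZ hs).imp (fun hs => ⟨s, hs, he.1⟩) fun hs => ⟨s, hs, he.2⟩
  | and φ ψ ihφ ihψ =>
    simp only [Formula.FV, Finset.coe_union, Set.eqOn_union] at h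
    refine ⟨ihφ hX.1 fun s' hs' => ?_, ihψ hX.2 fun s' hs' => ?_⟩ <;>
      obtain ⟨s, hs, he⟩ := h s' hs'
    exacts [⟨s, hs, he.1⟩, ⟨s, hs, he.2⟩]
  | ex x φ ih =>
    obtain ⟨Y, hY, hφ⟩ := hX
    refine ⟨{s' | ∃ s ∈ Y, Set.EqOn s' s φ.FV}, fun s' hs' => ?_, ih hφ fun _ hs => hs⟩
    obtain ⟨s, hs, he⟩ := h s' hs'
    obtain ⟨m, hm⟩ := hY s hs
    exact ⟨m, _, hm, eqOn_update_of_erase he m⟩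
  | all x φ ih =>
    obtain ⟨Y, hY, hφ⟩ := hX
    refine ⟨{s' | ∃ s ∈ Y, Set.EqOn s' s φ.FV}, fun s' hs' m => ?_, ih hφ fun _ hs => hs⟩
    obtain ⟨s, hs, he⟩ := h s' hs'
    exact ⟨_, hY s hs m, eqOn_update_of_erase he m⟩
  | flat φ ih =>
    intro s' hs'
    obtain ⟨s, hs, he⟩ := h s' hs'
    exact ih (hX s hs) (by simpa [Formula.FV] using he)

theorem TSat.mono [L.Structure M] {φ : Formula L} {X X' : Set (Var → M)}
    (hX : TSat M φ X) (h : X' ⊆ X) : TSat M φ X' :=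
  hX.of_eqOn fun s hs => ⟨s, h hs, fun _ _ => rfl⟩

theorem tSat_empty [L.Structure M] (φ : Formula L) : TSat M φ ∅ := by
  induction φ with
  | or φ ψ ihφ ihψ => exact ⟨∅, ∅, by simp, ihφ, ihψ⟩
  | and φ ψ ihφ ihψ => exact ⟨ihφ, ihψ⟩
  | ex x φ ih => exact ⟨∅, by simp, ih⟩
  | all x φ ih => exact ⟨∅, by simp, ih⟩
  | _ => simp [TSat]

/-! ### Comparison of partial and total assignments -/

section Extend

variable [Nonempty M] {D : Set Var}

theorem extend_update (s : D → M) (x : Var) (m : M) :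
    extend (update s x m) = Function.update (extend s) x m := by
  funext y
  rcases eq_or_ne y x with rfl | hne
  · simp [extend, update]
  · have h : y ∈ insert x D ↔ y ∈ D := by simp [hne]
    by_cases hy : y ∈ D
    · rw [Function.update_of_ne hne, extend, extend, dif_pos hy, dif_pos (h.2 hy), update,
        dif_neg hne]
    · rw [Function.update_of_ne hne, extend, extend, dif_neg hy, dif_neg (h.not.2 hy)]

/-- Witnesses for the relaxed clauses may be too large; downwards closure lets them be cut down to
those required by the exact clauses. -/
theorem sat_iff_tSat [L.Structure M] (φ : Formula L) (D : Set Var) (X : Set (D → M)) :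
    Sat M φ D X ↔ TSat M φ (extend '' X) := by
  induction φ generalizing D with
  | eq | ne | rel | nrel | dep => simp [Sat, TSat, val]
  | excl => simp [Sat, TSat, val, Function.ne_iff]
  | or φ ψ ihφ ihψ =>
    simp only [Sat, TSat, ihφ, ihψ]
    constructor
    · rintro ⟨Y, Z, rfl, hY, hZ⟩
      exact ⟨_, _, (Set.image_union ..).subset, hY, hZ⟩
    · rintro ⟨Y, Z, h, hY, hZ⟩
      refine ⟨X ∩ extend ⁻¹' Y, X ∩ extend ⁻¹' Z, ?_, hY.mono ?_, hZ.mono ?_⟩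
      · rw [← Set.inter_union_distrib_left, ← Set.preimage_union, eq_comm, Set.inter_eq_left]
        exact Set.image_subset_iff.1 h
      · rintro _ ⟨s, hs, rfl⟩
        exact hs.2
      · rintro _ ⟨s, hs, rfl⟩
        exact hs.2
  | and φ ψ ihφ ihψ => simp only [Sat, TSat, ihφ, ihψ]
  | ex x φ ih =>
    simp only [Sat, TSat, ih]
    constructor
    · rintro ⟨H, hH, h⟩
      refine ⟨_, ?_, h⟩
      rintro _ ⟨s, hs, rfl⟩
      obtain ⟨m, hm⟩ := hH ⟨s, hs⟩
      exact ⟨m, _, ⟨⟨s, hs⟩, m, hm, rfl⟩, extend_update s x m⟩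
    · rintro ⟨Y, hY, h⟩
      refine ⟨fun s => {m | Function.update (extend s.1) x m ∈ Y},
        fun s => hY _ ⟨s, s.2, rfl⟩, h.mono ?_⟩
      rintro _ ⟨_, ⟨s, m, hm, rfl⟩, rfl⟩
      rwa [extend_update]
  | all x φ ih =>
    simp only [Sat, TSat, ih]
    constructor
    · intro h
      refine ⟨_, ?_, h⟩
      rintro _ ⟨s, hs, rfl⟩ m
      exact ⟨_, ⟨s, hs, m, rfl⟩, extend_update s x m⟩
    · rintro ⟨Y, hY, h⟩
      refine h.mono ?_
      rintro _ ⟨_, ⟨s, hs, m, rfl⟩, rfl⟩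
      rw [extend_update]
      exact hY _ ⟨s, hs, rfl⟩ m
  | flat φ ih => simp [Sat, TSat, ih]

end Extend

/-! ### Eliminating the flattening operator -/

/-- All variables occurring in a formula, free or bound. -/
def Formula.vars : Formula L → Finset Var
  | .or φ ψ => φ.vars ∪ ψ.vars
  | .and φ ψ => φ.vars ∪ ψ.vars
  | .ex x φ => insert x φ.vars
  | .all x φ => insert x φ.vars
  | .flat φ => φ.vars
  | φ => φ.FV

theorem Formula.FV_subset_vars (φ : Formula L) : φ.FV ⊆ φ.vars := by
  induction φ with
  | or φ ψ ihφ ihψ | and φ ψ ihφ ihψ => exact Finset.union_subset_union ihφ ihψ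
  | ex x φ ih | all x φ ih =>
    exact (Finset.erase_subset _ _).trans (ih.trans (Finset.subset_insert _ _))
  | flat φ ih => exact ih
  | _ => exact subset_rfl

/-- Prefix the variables `ys` to every dependence and exclusion atom. -/
def Formula.guard {k : ℕ} (ys : Fin k → Var) : Formula L → Formula L
  | .dep ts t => .dep (Fin.append (fun i => .var (ys i)) ts) t
  | .excl ts₁ ts₂ =>
      .excl (Fin.append (fun i => .var (ys i)) ts₁) (Fin.append (fun i => .var (ys i)) ts₂)
  | .or φ ψ => .or (φ.guard ys) (ψ.guard ys)
  | .and φ ψ => .and (φ.guard ys) (ψ.guard ys)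
  | .ex x φ => .ex x (φ.guard ys)
  | .all x φ => .all x (φ.guard ys)
  | .flat φ => .flat (φ.guard ys)
  | φ => φ

theorem Formula.InLogic.guard {𝒟 : Set Constructor} {φ : Formula L} (h : φ.InLogic 𝒟) {k : ℕ}
    (ys : Fin k → Var) : (φ.guard ys).InLogic 𝒟 := by
  induction φ with
  | or φ ψ ihφ ihψ | and φ ψ ihφ ihψ => exact ⟨ihφ h.1, ihψ h.2⟩
  | ex x φ ih | all x φ ih => exact ih h
  | flat φ ih => exact ⟨h.1, ih h.2⟩
  | _ => exact h

theorem tupleVars_append {k l : ℕ} (ys : Fin k → Var) (ts : Fin l → L.Term Var) :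
    tupleVars (Fin.append (fun i => .var (ys i)) ts) = Finset.univ.image ys ∪ tupleVars ts := by
  ext x
  rw [← not_iff_not]
  simp [tupleVars, Fin.forall_fin_add, Language.Term.varFinset]
  grind

theorem Formula.FV_guard_subset (φ : Formula L) {k : ℕ} (ys : Fin k → Var) :
    (φ.guard ys).FV ⊆ φ.FV ∪ Finset.univ.image ys := by
  induction φ with
  | dep | excl =>
    simp only [guard, FV, tupleVars_append]
    intro x
    simp only [Finset.mem_union]
    tauto
  | or φ ψ ihφ ihψ | and φ ψ ihφ ihψ =>
    refine Finset.union_subset (ihφ.trans ?_) (ihψ.trans ?_) <;> intro x <;>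
      simp only [FV, Finset.mem_union] <;> tauto
  | ex x φ ih | all x φ ih =>
    intro y hy
    simp only [guard, FV, Finset.mem_erase, Finset.mem_union] at hy ⊢
    have := ih hy.2
    simp only [Finset.mem_union] at this
    tauto
  | flat φ ih => exact ih
  | _ => exact Finset.subset_union_left

/-- Quantifying a variable outside the guard leaves an assignment in the part it belonged to. -/
theorem update_comp_of_notMem {k : ℕ} {ys : Fin k → Var} {x : Var} (hx : ∀ i, ys i ≠ x)
    (s : Var → M) (m : M) : Function.update s x m ∘ ys = s ∘ ys :=
  funext fun i => by simp [hx i]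

/-- The guarded formula says that the formula holds in every part of the team on which the
variables `ys` are constant. -/
theorem tSat_guard_iff [L.Structure M] {φ : Formula L} {k : ℕ} {ys : Fin k → Var}
    (hys : ∀ i, ys i ∉ φ.vars) (X : Set (Var → M)) :
    TSat M (φ.guard ys) X ↔ ∀ a : Fin k → M, TSat M φ {s ∈ X | s ∘ ys = a} := by
  induction φ generalizing X with
  | eq | ne | rel | nrel => exact ⟨fun h a s hs => h s hs.1, fun h s hs => h _ s ⟨hs, rfl⟩⟩
  | dep ts t =>
    simp only [Formula.guard, TSat, Fin.forall_fin_add, Fin.append_left, Fin.append_right,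
      Language.Term.realize_var]
    constructor
    · rintro h a s ⟨hs, rfl⟩ s' ⟨hs', he⟩ ht
      exact h s hs s' hs' ⟨fun i => (congrFun he i).symm, ht⟩
    · rintro h s hs s' hs' ⟨he, ht⟩
      exact h (s ∘ ys) s ⟨hs, rfl⟩ s' ⟨hs', (funext he).symm⟩ ht
  | excl ts₁ ts₂ =>
    simp only [Formula.guard, TSat, Fin.forall_fin_add, Fin.append_left, Fin.append_right,
      Language.Term.realize_var]
    constructor
    · rintro h a s ⟨hs, rfl⟩ s' ⟨hs', he⟩ ht
      exact h s hs s' hs' ⟨fun i => (congrFun he i).symm, ht⟩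
    · rintro h s hs s' hs' ⟨he, ht⟩
      exact h (s ∘ ys) s ⟨hs, rfl⟩ s' ⟨hs', (funext he).symm⟩ ht
  | or φ ψ ihφ ihψ =>
    simp only [Formula.vars, Finset.mem_union, not_or, forall_and] at hys
    simp only [Formula.guard, TSat, ihφ hys.1, ihψ hys.2]
    constructor
    · rintro ⟨Y, Z, h, hY, hZ⟩ a
      refine ⟨_, _, fun s hs => ?_, hY a, hZ a⟩
      exact (h hs.1).imp (fun hY => ⟨hY, hs.2⟩) fun hZ => ⟨hZ, hs.2⟩
    · intro h
      -- Each part has its own witnesses; they are glued by consulting, for `s`, those chosen at the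
      -- value `s ∘ ys`.
      choose Y Z h hY hZ using h
      refine ⟨{s | s ∈ Y (s ∘ ys)}, {s | s ∈ Z (s ∘ ys)}, fun s hs => h _ ⟨hs, rfl⟩,
        fun a => (hY a).mono ?_, fun a => (hZ a).mono ?_⟩ <;>
      · rintro s ⟨hs, rfl⟩
        exact hs
  | and φ ψ ihφ ihψ =>
    simp only [Formula.vars, Finset.mem_union, not_or, forall_and] at hys
    simp only [Formula.guard, TSat, ihφ hys.1, ihψ hys.2, forall_and]
  | ex x φ ih =>
    simp only [Formula.vars, Finset.mem_insert, not_or, forall_and] at hys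
    simp only [Formula.guard, TSat, ih hys.2]
    constructor
    · rintro ⟨Y, h, hY⟩ a
      refine ⟨_, fun s hs => ?_, hY a⟩
      obtain ⟨m, hm⟩ := h s hs.1
      exact ⟨m, hm, by rw [update_comp_of_notMem hys.1, hs.2]⟩
    · intro h
      choose Y h hY using h
      refine ⟨{s | s ∈ Y (s ∘ ys)}, fun s hs => ?_, fun a => (hY a).mono ?_⟩
      · simpa only [Set.mem_ofPred_eq, update_comp_of_notMem hys.1] using h _ s ⟨hs, rfl⟩
      · rintro s ⟨hs, rfl⟩
        exact hs
  | all x φ ih =>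
    simp only [Formula.vars, Finset.mem_insert, not_or, forall_and] at hys
    simp only [Formula.guard, TSat, ih hys.2]
    constructor
    · rintro ⟨Y, h, hY⟩ a
      refine ⟨_, fun s hs m => ?_, hY a⟩
      exact ⟨h s hs.1 m, by rw [update_comp_of_notMem hys.1, hs.2]⟩
    · intro h
      choose Y h hY using h
      refine ⟨{s | s ∈ Y (s ∘ ys)}, fun s hs => ?_, fun a => (hY a).mono ?_⟩
      · simpa only [Set.mem_ofPred_eq, update_comp_of_notMem hys.1] using h _ s ⟨hs, rfl⟩
      · rintro s ⟨hs, rfl⟩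
        exact hs
  | flat φ ih =>
    simp only [Formula.guard, TSat, ih hys]
    constructor
    · rintro h a s ⟨hs, rfl⟩
      exact (h s hs (s ∘ ys)).mono (by simp)
    · intro h s hs a
      -- Each part of a singleton is contained in that singleton, and is empty unless `a` is the
      -- guard value of `s`.
      by_cases ha : s ∘ ys = a
      · exact (h a s ⟨hs, ha⟩).mono (Set.sep_subset _ _)
      · convert tSat_empty φ
        ext r
        simp only [Set.mem_ofPred_eq, Set.mem_singleton_iff, Set.mem_empty_iff_false, iff_false]
        rintro ⟨rfl, h⟩
        exact ha h

/-- `∃ x' (x' = x ∧ φ)` for all `x` in a list, where `x'` is the variable `N + x`. -/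
def Formula.withCopies (N : ℕ) (φ : Formula L) : List Var → Formula L
  | [] => φ
  | x :: l => .ex (N + x) (.and (.eq (.var (N + x)) (.var x)) (φ.withCopies N l))

/-- The assignment obtained by giving the variables `N + x` the values of `x`, for `x` in a list. -/
def assignCopies (N : ℕ) : List Var → (Var → M) → Var → M
  | [], s => s
  | x :: l, s => assignCopies N l (Function.update s (N + x) (s x))

theorem assignCopies_of_lt {N : ℕ} {y : Var} (hy : y < N) (l : List Var) (s : Var → M) :
    assignCopies N l s y = s y := by
  induction l generalizing s with
  | nil => rfl
  | cons x l ih => rw [assignCopies, ih, Function.update_of_ne (by unfold Var at *; omega)]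

theorem assignCopies_of_notMem {N : ℕ} {y : Var} {l : List Var} (hy : y ∉ l) (s : Var → M) :
    assignCopies N l s (N + y) = s (N + y) := by
  induction l generalizing s with
  | nil => rfl
  | cons x l ih =>
    simp only [List.mem_cons, not_or] at hy
    rw [assignCopies, ih hy.2, Function.update_of_ne (by simpa using hy.1)]

/-- Originals lie below `N` and are never overwritten, so even a repeated entry copies the original
value. -/
theorem assignCopies_of_mem {N : ℕ} {y : Var} {l : List Var} (hl : ∀ x ∈ l, x < N) (hy : y ∈ l)
    (s : Var → M) : assignCopies N l s (N + y) = s y := by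
  induction l generalizing s with
  | nil => simp at hy
  | cons x l ih =>
    simp only [List.forall_mem_cons] at hl
    rw [assignCopies]
    by_cases hyl : y ∈ l
    · have := hl.2 y hyl
      rw [ih hl.2 hyl, Function.update_of_ne (by unfold Var at *; omega)]
    · obtain rfl : y = x := by simpa [hyl] using hy
      rw [assignCopies_of_notMem hyl, Function.update_self]

/-- The equations force every value chosen for a copy, so the lax quantifiers have no real choice.
-/
theorem tSat_withCopies_iff [L.Structure M] {φ : Formula L} {N : ℕ} {l : List Var}
    (hl : ∀ x ∈ l, x < N) (X : Set (Var → M)) :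
    TSat M (φ.withCopies N l) X ↔ TSat M φ (assignCopies N l '' X) := by
  induction l generalizing X with
  | nil => simp [Formula.withCopies, assignCopies]
  | cons x l ih =>
    simp only [List.forall_mem_cons] at hl
    have hx : x ≠ N + x := by have := hl.1; unfold Var at *; omega
    simp only [Formula.withCopies, TSat, ih hl.2, Language.Term.realize_var]
    constructor
    · rintro ⟨Y, h, he, hY⟩
      refine hY.mono ?_
      rintro _ ⟨s, hs, rfl⟩
      obtain ⟨m, hm⟩ := h s hs
      have := he _ hm
      rw [Function.update_self, Function.update_of_ne hx] at this
      exact ⟨_, hm, by rw [assignCopies, this]⟩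
    · intro h
      refine ⟨(fun s => Function.update s (N + x) (s x)) '' X, fun s hs => ⟨_, s, hs, rfl⟩, ?_, ?_⟩
      · rintro _ ⟨s, -, rfl⟩
        simp [Function.update_of_ne hx]
      · rwa [Set.image_image]

/-- The quantifiers bind the copies; this keeps the guard variables from becoming free in
`Formula.flatten`. -/
theorem Formula.FV_withCopies_subset (φ : Formula L) (N : ℕ) (l : List Var) :
    (φ.withCopies N l).FV ⊆ l.toFinset ∪ φ.FV \ l.toFinset.image (N + ·) := by
  induction l with
  | nil => simp [withCopies]
  | cons x l ih =>
    intro y hy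
    simp only [withCopies, FV, Finset.mem_erase, Finset.mem_union, Language.Term.varFinset,
      Finset.mem_singleton] at hy
    rcases hy with ⟨hne, (rfl | rfl) | hy⟩
    · exact absurd rfl hne
    · simp
    · have := ih hy
      simp only [Finset.mem_union, List.toFinset_cons, Finset.mem_insert, Finset.mem_sdiff,
        Finset.image_insert] at this ⊢
      tauto

theorem Formula.InLogic.withCopies {𝒟 : Set Constructor} {φ : Formula L} (h : φ.InLogic 𝒟) (N : ℕ)
    (l : List Var) : (φ.withCopies N l).InLogic 𝒟 := by
  induction l with
  | nil => exact h
  | cons x l ih => exact ⟨trivial, ih⟩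

/-- A bound on the variables of a formula. -/
def Formula.bound (φ : Formula L) : ℕ := φ.vars.sup id + 1

theorem Formula.lt_bound {φ : Formula L} {x : Var} (hx : x ∈ φ.vars) : x < φ.bound :=
  Nat.lt_succ_of_le (Finset.le_sup (f := id) hx)

/-- A formula without the flattening operator that is equivalent to `F φ`, for `φ` without the
flattening operator. -/
noncomputable def Formula.flatten (φ : Formula L) : Formula L :=
  (φ.guard fun i => φ.bound + φ.FV.toList.get i).withCopies φ.bound φ.FV.toList

theorem Formula.FV_flatten_subset (φ : Formula L) : φ.flatten.FV ⊆ φ.FV := by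
  intro x hx
  have := FV_withCopies_subset _ _ _ hx
  simp only [Finset.toList_toFinset, Finset.mem_union, Finset.mem_sdiff, Finset.mem_image] at this
  rcases this with h | ⟨h, hn⟩
  · exact h
  · rcases Finset.mem_union.1 (FV_guard_subset _ _ h) with h | h
    · exact h
    · obtain ⟨i, -, rfl⟩ := Finset.mem_image.1 h
      exact absurd ⟨_, Finset.mem_toList.1 (List.get_mem _ i), rfl⟩ hn

theorem tSat_flatten_iff [L.Structure M] (φ : Formula L) (X : Set (Var → M)) :
    TSat M φ.flatten X ↔ ∀ s ∈ X, TSat M φ {s} := by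
  have hl : ∀ x ∈ φ.FV.toList, x < φ.bound := fun x hx =>
    φ.lt_bound (φ.FV_subset_vars (Finset.mem_toList.1 hx))
  have hcopy : ∀ s : Var → M, Set.EqOn (assignCopies φ.bound φ.FV.toList s) s φ.FV := fun s x hx =>
    assignCopies_of_lt (hl x (Finset.mem_toList.2 hx)) _ _
  rw [Formula.flatten, tSat_withCopies_iff hl, tSat_guard_iff]
  · constructor
    · intro h s hs
      refine (h _).of_eqOn (X' := {s}) fun s' hs' =>
        ⟨assignCopies φ.bound φ.FV.toList s, ⟨⟨s, hs, rfl⟩, rfl⟩, ?_⟩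
      obtain rfl := Set.mem_singleton_iff.1 hs'
      exact (hcopy _).symm
    · intro h a
      -- Members of one part agree on the copies, hence on the free variables of `φ`. In a nonempty
      -- part, any one member can therefore stand for all.
      obtain he | ⟨_, ⟨s, hs, rfl⟩, ha⟩ :=
        {s ∈ assignCopies φ.bound φ.FV.toList '' X |
          (s ∘ fun i => φ.bound + φ.FV.toList.get i) = a}.eq_empty_or_nonempty
      · rw [he]
        exact tSat_empty φ
      · refine (h s hs).of_eqOn ?_
        rintro _ ⟨⟨r, hr, rfl⟩, ha'⟩
        refine ⟨s, rfl, (hcopy r).trans fun x hx => ?_⟩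
        obtain ⟨i, rfl⟩ := List.get_of_mem (Finset.mem_toList.2 hx)
        have := congrFun (ha'.trans ha.symm) i
        simpa only [Function.comp_apply, assignCopies_of_mem hl (List.get_mem _ i)] using this
  · intro i hi
    have := φ.lt_bound hi
    unfold Var at *
    omega

/-- Eliminate the flattening operator. -/
noncomputable def Formula.unflat : Formula L → Formula L
  | .or φ ψ => .or φ.unflat ψ.unflat
  | .and φ ψ => .and φ.unflat ψ.unflat
  | .ex x φ => .ex x φ.unflat
  | .all x φ => .all x φ.unflat
  | .flat φ => φ.unflat.flatten
  | φ => φ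

theorem tSat_unflat_iff [L.Structure M] (φ : Formula L) (X : Set (Var → M)) :
    TSat M φ.unflat X ↔ TSat M φ X := by
  induction φ generalizing X with
  | or φ ψ ihφ ihψ | and φ ψ ihφ ihψ => simp only [Formula.unflat, TSat, ihφ, ihψ]
  | ex x φ ih | all x φ ih => simp only [Formula.unflat, TSat, ih]
  | flat φ ih => simp only [Formula.unflat, tSat_flatten_iff, TSat, ih]
  | _ => rfl

theorem Formula.FV_unflat_subset (φ : Formula L) : φ.unflat.FV ⊆ φ.FV := by
  induction φ with
  | or φ ψ ihφ ihψ | and φ ψ ihφ ihψ => exact Finset.union_subset_union ihφ ihψ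
  | ex x φ ih | all x φ ih => exact Finset.erase_subset_erase _ ih
  | flat φ ih => exact φ.unflat.FV_flatten_subset.trans ih
  | _ => exact subset_rfl

/-- Guarding lengthens atoms without changing their kind, and copying is first-order, so no new
constructor appears. -/
theorem Formula.InLogic.unflat {𝒟 𝒟' : Set Constructor} (h𝒟 : 𝒟' ⊆ insert .flat 𝒟)
    {φ : Formula L} (h : φ.InLogic 𝒟') : φ.unflat.InLogic 𝒟 := by
  induction φ with
  | dep => exact (h𝒟 h).resolve_left (by simp)
  | excl => exact (h𝒟 h).resolve_left (by simp)
  | or φ ψ ihφ ihψ | and φ ψ ihφ ihψ => exact ⟨ihφ h.1, ihψ h.2⟩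
  | ex x φ ih | all x φ ih => exact ih h
  | flat φ ih => exact ((ih h.2).guard _).withCopies _ _
  | _ => trivial

theorem Formula.InLogic.mono {𝒟 𝒟' : Set Constructor} (h𝒟 : 𝒟 ⊆ 𝒟') {φ : Formula L}
    (h : φ.InLogic 𝒟) : φ.InLogic 𝒟' := by
  induction φ with
  | dep | excl => exact h𝒟 h
  | or φ ψ ihφ ihψ | and φ ψ ihφ ihψ => exact ⟨ihφ h.1, ihψ h.2⟩
  | ex x φ ih | all x φ ih => exact ih h
  | flat φ ih => exact ⟨h𝒟 h.1, ih h.2⟩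
  | _ => trivial

theorem sat_unflat_iff [L.Structure M] [Nonempty M] (φ : Formula L) (D : Set Var)
    (X : Set (D → M)) : Sat M φ.unflat D X ↔ Sat M φ D X := by
  rw [sat_iff_tSat, sat_iff_tSat, tSat_unflat_iff]

/-- The flattening operator does not increase the expressive power of a logic. -/
theorem sameExpressivePower_flat (L : FirstOrder.Language.{u, v}) {𝒟 𝒟' : Set Constructor}
    (h : 𝒟 ⊆ 𝒟') (h' : 𝒟' ⊆ insert .flat 𝒟) : SameExpressivePower.{u, v, w} L 𝒟' 𝒟 :=
  ⟨fun φ hφ => ⟨φ.unflat, hφ.unflat h', φ.FV_unflat_subset,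
      fun _ _ _ D X _ _ => (sat_unflat_iff φ D X).symm⟩,
    fun φ hφ => ⟨φ, hφ.mono h, subset_rfl, fun _ _ _ _ _ _ _ => Iff.rfl⟩⟩

/-! ### Translation into existential second-order logic -/

/-- The subformula occurrences of a formula. -/
def Formula.Occ : Formula L → Type
  | .or φ ψ => Option (φ.Occ ⊕ ψ.Occ)
  | .and φ ψ => Option (φ.Occ ⊕ ψ.Occ)
  | .ex _ φ => Option φ.Occ
  | .all _ φ => Option φ.Occ
  | _ => Option Empty

instance Formula.finite_occ (φ : Formula L) : Finite φ.Occ := by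
  induction φ with
  | or φ ψ _ _ | and φ ψ _ _ => exact inferInstanceAs (Finite (Option (φ.Occ ⊕ ψ.Occ)))
  | ex _ φ _ | all _ φ _ => exact inferInstanceAs (Finite (Option φ.Occ))
  | _ => exact inferInstanceAs (Finite (Option Empty))

/-- The occurrence of a formula in itself. -/
def Formula.root : (φ : Formula L) → φ.Occ
  | .eq _ _ => (none : Option Empty)
  | .ne _ _ => (none : Option Empty)
  | .rel _ _ => (none : Option Empty)
  | .nrel _ _ => (none : Option Empty)
  | .dep _ _ => (none : Option Empty)
  | .excl _ _ => (none : Option Empty)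
  | .or φ ψ => (none : Option (φ.Occ ⊕ ψ.Occ))
  | .and φ ψ => (none : Option (φ.Occ ⊕ ψ.Occ))
  | .ex _ φ => (none : Option φ.Occ)
  | .all _ φ => (none : Option φ.Occ)
  | .flat _ => (none : Option Empty)

/-- The relations `S p` satisfy the local conditions making them teams for the
subformula occurrences `p` of a formula without flattening operators. The assignments in these
teams are tuples indexed by `Fin N`, the value of the variable `x` being the entry with
index `c x`. -/
def IsLabelling (M : Type w) [L.Structure M] {N : ℕ} (c : Var → Fin N) :
    (φ : Formula L) → (φ.Occ → Set (Fin N → M)) → Prop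
  | .or φ ψ, S =>
      (∀ a ∈ S none, a ∈ S (some (.inl φ.root)) ∨ a ∈ S (some (.inr ψ.root))) ∧
        IsLabelling M c φ (fun p => S (some (.inl p))) ∧
        IsLabelling M c ψ (fun p => S (some (.inr p)))
  | .and φ ψ, S =>
      (∀ a ∈ S none, a ∈ S (some (.inl φ.root)) ∧ a ∈ S (some (.inr ψ.root))) ∧
        IsLabelling M c φ (fun p => S (some (.inl p))) ∧
        IsLabelling M c ψ (fun p => S (some (.inr p)))
  | .ex x φ, S =>
      (∀ a ∈ S none, ∃ m, Function.update a (c x) m ∈ S (some φ.root)) ∧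
        IsLabelling M c φ (fun p => S (some p))
  | .all x φ, S =>
      (∀ a ∈ S none, ∀ m, Function.update a (c x) m ∈ S (some φ.root)) ∧
        IsLabelling M c φ (fun p => S (some p))
  | .flat _, _ => False
  | φ, S => TSat M φ ((· ∘ c) '' S φ.root)

/-- Injectivity of the coding ensures that changing the entry for `x` disturbs no other variable in
`V`. -/
theorem eqOn_update_comp {N : ℕ} {c : Var → Fin N} {x : Var} {V : Set Var}
    (hc : Set.InjOn c (insert x V)) {a : Fin N → M} {s : Var → M}
    (h : Set.EqOn (a ∘ c) s (V \ {x})) (m : M) :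
    Set.EqOn (Function.update a (c x) m ∘ c) (Function.update s x m) V := by
  intro y hy
  rcases eq_or_ne y x with rfl | hne
  · simp
  · have hcy : c y ≠ c x := fun he => hne (hc (Or.inr hy) (Or.inl rfl) he)
    simpa [hne, hcy] using h ⟨hy, hne⟩

/-- Distinct occurrences carry independent relations, so labellings of the immediate subformulas
combine freely; only inclusions link them to the root. -/
theorem exists_isLabelling_iff [L.Structure M] {N : ℕ} {c : Var → Fin N} {φ : Formula L}
    (hφ : φ.InLogic {.dep, .excl}) (hc : Set.InjOn c φ.vars) (X : Set (Fin N → M)) :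
    (∃ S, IsLabelling M c φ S ∧ X ⊆ S φ.root) ↔ TSat M φ ((· ∘ c) '' X) := by
  induction φ generalizing X with
  | eq | ne | rel | nrel | dep | excl =>
    exact ⟨fun ⟨_, h, hX⟩ => TSat.mono h (Set.image_mono hX), fun h => ⟨fun _ => X, h, subset_rfl⟩⟩
  | or φ ψ ihφ ihψ =>
    simp only [Formula.vars, Finset.coe_union] at hc
    replace ihφ := ihφ hφ.1 (hc.mono Set.subset_union_left)
    replace ihψ := ihψ hφ.2 (hc.mono Set.subset_union_right)
    constructor
    · rintro ⟨S, ⟨h, hSφ, hSψ⟩, hX⟩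
      refine ⟨_, _, ?_, (ihφ _).1 ⟨_, hSφ, subset_rfl⟩, (ihψ _).1 ⟨_, hSψ, subset_rfl⟩⟩
      rintro _ ⟨a, ha, rfl⟩
      exact (h a (hX ha)).imp (fun h => ⟨a, h, rfl⟩) fun h => ⟨a, h, rfl⟩
    · rintro ⟨Y, Z, h, hY, hZ⟩
      obtain ⟨S, hS, hYS⟩ := (ihφ ((· ∘ c) ⁻¹' Y)).2 (hY.mono (Set.image_preimage_subset _ _))
      obtain ⟨T, hT, hZT⟩ := (ihψ ((· ∘ c) ⁻¹' Z)).2 (hZ.mono (Set.image_preimage_subset _ _))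
      exact ⟨fun p => p.elim X (Sum.elim S T), ⟨fun a ha =>
        (h ⟨a, ha, rfl⟩).imp (fun h => hYS h) fun h => hZT h, hS, hT⟩, subset_rfl⟩
  | and φ ψ ihφ ihψ =>
    simp only [Formula.vars, Finset.coe_union] at hc
    replace ihφ := ihφ hφ.1 (hc.mono Set.subset_union_left)
    replace ihψ := ihψ hφ.2 (hc.mono Set.subset_union_right)
    constructor
    · rintro ⟨S, ⟨h, hSφ, hSψ⟩, hX⟩
      exact ⟨(ihφ _).1 ⟨_, hSφ, fun a ha => (h a (hX ha)).1⟩,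
        (ihψ _).1 ⟨_, hSψ, fun a ha => (h a (hX ha)).2⟩⟩
    · rintro ⟨hY, hZ⟩
      obtain ⟨S, hS, hYS⟩ := (ihφ X).2 hY
      obtain ⟨T, hT, hZT⟩ := (ihψ X).2 hZ
      exact ⟨fun p => p.elim X (Sum.elim S T), ⟨fun a ha => ⟨hYS ha, hZT ha⟩, hS, hT⟩, subset_rfl⟩
  | ex x φ ih =>
    simp only [Formula.vars, Finset.coe_insert] at hc
    replace ih := ih hφ (hc.mono (Set.subset_insert _ _))
    have hc' : Set.InjOn c (insert x φ.FV) :=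
      hc.mono (Set.insert_subset_insert (Finset.coe_subset.2 φ.FV_subset_vars))
    constructor
    · rintro ⟨S, ⟨h, hS⟩, hX⟩
      -- An updated assignment need not have the form `b ∘ c`, since `c` may identify `x` with
      -- variables outside the formula. Hence the team is closed under agreement on free variables.
      refine ⟨{s | ∃ a ∈ S (some φ.root), Set.EqOn s (a ∘ c) φ.FV}, ?_,
        ((ih _).1 ⟨_, hS, subset_rfl⟩).of_eqOn fun s ⟨a, ha, he⟩ => ⟨_, ⟨a, ha, rfl⟩, he⟩⟩
      rintro _ ⟨a, ha, rfl⟩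
      obtain ⟨m, hm⟩ := h a (hX ha)
      exact ⟨m, _, hm, (eqOn_update_comp hc' (fun _ _ => rfl) m).symm⟩
    · rintro ⟨Y, h, hY⟩
      obtain ⟨S, hS, hYS⟩ := (ih {b | ∃ s ∈ Y, Set.EqOn (b ∘ c) s φ.FV}).2
        (hY.of_eqOn (by rintro _ ⟨b, hb, rfl⟩; exact hb))
      refine ⟨fun p => p.elim X S, ⟨fun a ha => ?_, hS⟩, subset_rfl⟩
      obtain ⟨m, hm⟩ := h _ ⟨a, ha, rfl⟩
      exact ⟨m, hYS ⟨_, hm, eqOn_update_comp hc' (fun _ _ => rfl) m⟩⟩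
  | all x φ ih =>
    simp only [Formula.vars, Finset.coe_insert] at hc
    replace ih := ih hφ (hc.mono (Set.subset_insert _ _))
    have hc' : Set.InjOn c (insert x φ.FV) :=
      hc.mono (Set.insert_subset_insert (Finset.coe_subset.2 φ.FV_subset_vars))
    constructor
    · rintro ⟨S, ⟨h, hS⟩, hX⟩
      refine ⟨{s | ∃ a ∈ S (some φ.root), Set.EqOn s (a ∘ c) φ.FV}, ?_,
        ((ih _).1 ⟨_, hS, subset_rfl⟩).of_eqOn fun s ⟨a, ha, he⟩ => ⟨_, ⟨a, ha, rfl⟩, he⟩⟩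
      rintro _ ⟨a, ha, rfl⟩ m
      exact ⟨_, h a (hX ha) m, (eqOn_update_comp hc' (fun _ _ => rfl) m).symm⟩
    · rintro ⟨Y, h, hY⟩
      obtain ⟨S, hS, hYS⟩ := (ih {b | ∃ s ∈ Y, Set.EqOn (b ∘ c) s φ.FV}).2
        (hY.of_eqOn (by rintro _ ⟨b, hb, rfl⟩; exact hb))
      refine ⟨fun p => p.elim X S, ⟨fun a ha m => ?_, hS⟩, subset_rfl⟩
      exact hYS ⟨_, h _ ⟨a, ha, rfl⟩ m, eqOn_update_comp hc' (fun _ _ => rfl) m⟩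
  | flat φ => exact absurd hφ.1 (by simp)

/-- The universal closure of a first-order formula with finitely many variables. -/
noncomputable def allClosure {β : Type} [Finite β] (f : L.Formula β) : L.Sentence :=
  Language.Formula.iAlls β (f.relabel Sum.inr)

@[simp]
theorem realize_allClosure [L.Structure M] {β : Type} [Finite β] (f : L.Formula β) :
    M ⊨ allClosure f ↔ ∀ a : β → M, f.Realize a := by
  simp only [Language.Sentence.Realize, allClosure, Language.Formula.realize_iAlls,
    Language.Formula.realize_relabel]
  rfl

theorem realize_sentence_inf [L.Structure M] (χ₁ χ₂ : L.Sentence) :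
    M ⊨ χ₁ ⊓ χ₂ ↔ M ⊨ χ₁ ∧ M ⊨ χ₂ :=
  Language.Formula.realize_inf

theorem elim_update_inl {N : ℕ} (a : Fin N → M) (i : Fin N) (m : Unit → M) :
    (fun j => Sum.elim a m (Function.update Sum.inl i (Sum.inr ()) j)) =
      Function.update a i (m ()) := by
  funext j
  rcases eq_or_ne j i with rfl | hne <;> simp [*]

/-- Being a labelling is expressed by a first-order sentence. -/
theorem exists_sentence_isLabelling {L' : FirstOrder.Language.{u', v'}} (ι : L →ᴸ L') {N : ℕ}
    (c : Var → Fin N) (φ : Formula L) (σ : φ.Occ → L'.Relations N) :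
    ∃ χ : L'.Sentence, ∀ (M : Type w) [L.Structure M] [L'.Structure M] [ι.IsExpansionOn M],
      M ⊨ χ ↔ IsLabelling M c φ fun p => {a | Language.Structure.RelMap (σ p) a} := by
  -- Literals test one assignment at a time, so one universally quantified tuple suffices.
  have lit (r : L'.Relations N) (f : L.Formula (Fin N)) :
      ∃ χ : L'.Sentence, ∀ (M : Type w) [L.Structure M] [L'.Structure M] [ι.IsExpansionOn M],
        M ⊨ χ ↔ ∀ a, Language.Structure.RelMap r a → f.Realize (M := M) a :=
    ⟨allClosure ((r.formula Language.var).imp (ι.onFormula f)), fun M _ _ _ => by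
      simp [Language.Formula.realize_rel]⟩
  -- Dependence and exclusion atoms compare two assignments, hence two tuples.
  have atom (r : L'.Relations N) (f : L.Formula (Fin N ⊕ Fin N)) :
      ∃ χ : L'.Sentence, ∀ (M : Type w) [L.Structure M] [L'.Structure M] [ι.IsExpansionOn M],
        M ⊨ χ ↔ ∀ a, Language.Structure.RelMap r a → ∀ b, Language.Structure.RelMap r b →
          f.Realize (M := M) (Sum.elim a b) :=
    ⟨allClosure ((r.formula fun i => .var (.inl i)).imp
      ((r.formula fun i => .var (.inr i)).imp (ι.onFormula f))), fun M _ _ _ => by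
      simp only [realize_allClosure, Language.Formula.realize_imp, Language.Formula.realize_rel,
        Language.LHom.realize_onFormula, Language.Term.realize_var]
      exact ⟨fun h a ha b hb => h (Sum.elim a b) ha hb, fun h a ha hb => by
        simpa only [Sum.elim_comp_inl_inr] using h (a ∘ Sum.inl) ha (a ∘ Sum.inr) hb⟩⟩
  induction φ with
  | eq t₁ t₂ =>
    obtain ⟨χ, hχ⟩ := lit (σ (none : Option Empty)) ((t₁.relabel c).equal (t₂.relabel c))
    exact ⟨χ, fun M _ _ _ => (hχ M).trans
      (by simp [IsLabelling, TSat, Formula.root, Language.Formula.realize_equal])⟩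
  | ne t₁ t₂ =>
    obtain ⟨χ, hχ⟩ := lit (σ (none : Option Empty)) ((t₁.relabel c).equal (t₂.relabel c)).not
    exact ⟨χ, fun M _ _ _ => (hχ M).trans
      (by simp [IsLabelling, TSat, Formula.root, Language.Formula.realize_equal])⟩
  | rel R ts =>
    obtain ⟨χ, hχ⟩ := lit (σ (none : Option Empty)) (R.formula fun i => (ts i).relabel c)
    exact ⟨χ, fun M _ _ _ => (hχ M).trans
      (by simp [IsLabelling, TSat, Formula.root, Language.Formula.realize_rel])⟩
  | nrel R ts =>
    obtain ⟨χ, hχ⟩ := lit (σ (none : Option Empty)) (R.formula fun i => (ts i).relabel c).not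
    exact ⟨χ, fun M _ _ _ => (hχ M).trans
      (by simp [IsLabelling, TSat, Formula.root, Language.Formula.realize_rel])⟩
  | dep ts t =>
    obtain ⟨χ, hχ⟩ := atom (σ (none : Option Empty))
      (Language.Formula.imp (Language.BoundedFormula.iInf fun i =>
          ((ts i).relabel (Sum.inl ∘ c)).equal ((ts i).relabel (Sum.inr ∘ c)))
        ((t.relabel (Sum.inl ∘ c)).equal (t.relabel (Sum.inr ∘ c))))
    refine ⟨χ, fun M _ _ _ => (hχ M).trans ?_⟩
    simp [IsLabelling, TSat, Formula.root, Language.Formula.Realize, Language.Term.equal,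
      ← Function.comp_assoc]
  | excl ts₁ ts₂ =>
    obtain ⟨χ, hχ⟩ := atom (σ (none : Option Empty))
      (Language.Formula.not (Language.BoundedFormula.iInf fun i =>
          ((ts₁ i).relabel (Sum.inl ∘ c)).equal ((ts₂ i).relabel (Sum.inr ∘ c))))
    refine ⟨χ, fun M _ _ _ => (hχ M).trans ?_⟩
    simp [IsLabelling, TSat, Formula.root, Language.Formula.Realize, Language.Term.equal,
      ← Function.comp_assoc]
  | or φ ψ ihφ ihψ =>
    obtain ⟨χ₁, h₁⟩ := ihφ fun p => σ (some (.inl p))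
    obtain ⟨χ₂, h₂⟩ := ihψ fun p => σ (some (.inr p))
    let r (p) : L'.Formula (Fin N) := (σ p).formula Language.var
    refine ⟨allClosure ((r none).imp (r (some (.inl φ.root)) ⊔ r (some (.inr ψ.root)))) ⊓
      (χ₁ ⊓ χ₂), fun M _ _ _ => ?_⟩
    rw [IsLabelling, ← h₁ M, ← h₂ M, realize_sentence_inf, realize_sentence_inf]
    simp [r, Language.Formula.realize_rel]
  | and φ ψ ihφ ihψ =>
    obtain ⟨χ₁, h₁⟩ := ihφ fun p => σ (some (.inl p))
    obtain ⟨χ₂, h₂⟩ := ihψ fun p => σ (some (.inr p))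
    let r (p) : L'.Formula (Fin N) := (σ p).formula Language.var
    refine ⟨allClosure ((r none).imp (r (some (.inl φ.root)) ⊓ r (some (.inr ψ.root)))) ⊓
      (χ₁ ⊓ χ₂), fun M _ _ _ => ?_⟩
    rw [IsLabelling, ← h₁ M, ← h₂ M, realize_sentence_inf, realize_sentence_inf]
    simp [r, Language.Formula.realize_rel]
  | ex x φ ih =>
    obtain ⟨χ, h⟩ := ih fun p => σ (some p)
    refine ⟨allClosure (((σ none).formula Language.var).imp
      (Language.Formula.iExs Unit ((σ (some φ.root)).formula fun i =>
        .var (Function.update Sum.inl (c x) (Sum.inr ()) i)))) ⊓ χ, fun M _ _ _ => ?_⟩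
    rw [IsLabelling, ← h M, realize_sentence_inf, realize_allClosure]
    simp only [Language.Formula.realize_imp, Language.Formula.realize_rel,
      Language.Formula.realize_iExs, Language.Term.realize_var, elim_update_inl]
    simp only [Set.mem_ofPred_eq, (Equiv.funUnique Unit M).surjective.exists]
    rfl
  | all x φ ih =>
    obtain ⟨χ, h⟩ := ih fun p => σ (some p)
    refine ⟨allClosure (((σ none).formula Language.var).imp
      (Language.Formula.iAlls Unit ((σ (some φ.root)).formula fun i =>
        .var (Function.update Sum.inl (c x) (Sum.inr ()) i)))) ⊓ χ, fun M _ _ _ => ?_⟩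
    rw [IsLabelling, ← h M, realize_sentence_inf, realize_allClosure]
    simp only [Language.Formula.realize_imp, Language.Formula.realize_rel,
      Language.Formula.realize_iAlls, Language.Term.realize_var, elim_update_inl]
    simp only [Set.mem_ofPred_eq, (Equiv.funUnique Unit M).surjective.forall]
    rfl
  | flat φ => exact ⟨⊥, fun M _ _ _ => by simp [IsLabelling]⟩

/-- Every formula without flattening operators is equivalent to a downwards closed
existential second-order formula about the relation defined by the team. -/
theorem exists_esoFormula {φ : Formula L} (hφ : φ.InLogic {.dep, .excl}) {n : ℕ} {x : Fin n → Var}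
    (hx : (φ.FV : Set Var) ⊆ Set.range x) :
    ∃ θ : ESOFormula L n, ESOFormula.DownwardsClosed.{u, v, w} θ ∧
      ∀ (M : Type w) [L.Structure M] [Nonempty M] (D : Set Var) (hD : ∀ i, x i ∈ D)
        (X : Set (D → M)), Sat M φ D X ↔ ESOFormula.Realize θ M (teamRel X x hD) := by
  let V := φ.vars ∪ Finset.univ.image x
  -- Reduction modulo a number exceeding every element of `V` is injective on `V`.
  obtain ⟨N, c, hc⟩ : ∃ (N : ℕ) (c : Var → Fin N), Set.InjOn c V :=
    ⟨V.sup id + 1, Fin.ofNat _, fun y hy z hz h => by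
      have hy : y < V.sup id + 1 :=
        Nat.lt_succ_of_le (Finset.le_sup (f := id) (Finset.mem_coe.1 hy))
      have hz : z < V.sup id + 1 :=
        Nat.lt_succ_of_le (Finset.le_sup (f := id) (Finset.mem_coe.1 hz))
      have h : y % (V.sup id + 1) = z % (V.sup id + 1) := congrArg Fin.val h
      rwa [Nat.mod_eq_of_lt hy, Nat.mod_eq_of_lt hz] at h⟩
  obtain ⟨m, ⟨e⟩⟩ := Finite.exists_equiv_fin φ.Occ
  let L₁ := L.sum (relLang fun _ : Fin 1 => n)
  let L₂ := L₁.sum (relLang fun _ : Fin m => N)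
  let σ (p : φ.Occ) : L₂.Relations N := Sum.inr ⟨e p, rfl⟩
  let ρ : L₂.Relations n := Sum.inl (Sum.inr ⟨0, rfl⟩)
  obtain ⟨χ, hχ⟩ := exists_sentence_isLabelling.{u, v, w}
    (Language.LHom.sumInl.comp Language.LHom.sumInl : L →ᴸ L₂) c φ σ
  -- The root must contain all tuples whose `x`-entries lie in `R`. The other entries are
  -- unrestricted, which locality makes harmless.
  let θ : ESOFormula L n := ⟨m, fun _ => N, χ ⊓ allClosure
    ((ρ.formula fun i => .var (c (x i))).imp ((σ φ.root).formula Language.var))⟩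
  have key : ∀ (M : Type w) [L.Structure M] (A : Set (Fin n → M)), ESOFormula.Realize θ M A ↔
      TSat M φ ((· ∘ c) '' {a | a ∘ c ∘ x ∈ A}) := by
    intro M _ A
    rw [← exists_isLabelling_iff hφ (hc.mono (by simp [V]))]
    let _ := relStructure (fun _ : Fin 1 => n) fun _ => A
    have step : ∀ S : Fin m → Set (Fin N → M),
        (letI := relStructure (fun _ : Fin m => N) S; M ⊨ θ.matrix) ↔
          IsLabelling M c φ (fun p => S (e p)) ∧ {a | a ∘ c ∘ x ∈ A} ⊆ S (e φ.root) := by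
      intro S
      let _ := relStructure (fun _ : Fin m => N) S
      have : (Language.LHom.sumInl.comp Language.LHom.sumInl : L →ᴸ L₂).IsExpansionOn M :=
        ⟨fun _ _ => rfl, fun _ _ => rfl⟩
      refine (realize_sentence_inf _ _).trans (and_congr (hχ M) ?_)
      simp only [realize_allClosure, Language.Formula.realize_imp, Language.Formula.realize_rel,
        Language.Term.realize_var]
      rfl
    refine (exists_congr step).trans
      ⟨fun ⟨S, h⟩ => ⟨_, h⟩, fun ⟨S, h⟩ => ⟨fun i => S (e.symm i), ?_⟩⟩
    simpa using h
  refine ⟨θ, fun M _ _ A A' hA h => ?_, fun M _ _ D hD X => ?_⟩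
  · rw [key] at h ⊢
    exact h.mono (Set.image_mono fun a ha => hA ha)
  · rw [key, sat_iff_tSat]
    have hext : ∀ (s : D → M) i, extend s (x i) = s ⟨x i, hD i⟩ := fun s i => dif_pos (hD i)
    constructor <;> refine fun h => h.of_eqOn ?_
    · rintro _ ⟨a, ⟨s, hs, ha⟩, rfl⟩
      refine ⟨_, ⟨s, hs, rfl⟩, fun y hy => ?_⟩
      obtain ⟨i, rfl⟩ := hx hy
      rw [hext]
      exact congrFun ha i
    · rintro _ ⟨s, hs, rfl⟩
      -- Decoding indices back to variables turns an assignment into a tuple with the required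
      -- entries.
      have hinv : ∀ i, Function.invFunOn c V (c (x i)) = x i := fun i =>
        hc.leftInvOn_invFunOn (by simp [V])
      refine ⟨_, ⟨extend s ∘ Function.invFunOn c V, ⟨s, hs, ?_⟩, rfl⟩, fun y hy => ?_⟩
      · funext i
        simp [hinv, hext]
      · obtain ⟨i, rfl⟩ := hx hy
        simp [hinv]

/-! ### The empty team and the main theorem -/

theorem sat_empty [L.Structure M] [Nonempty M] (φ : Formula L) (D : Set Var) :
    Sat M φ D ∅ := by
  rw [sat_iff_tSat, Set.image_empty]
  exact tSat_empty φ

theorem teamRel_eq_empty_iff {D : Set Var} {X : Set (D → M)} {n : ℕ} {x : Fin n → Var}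
    (hx : ∀ i, x i ∈ D) : (∀ a, a ∉ teamRel X x hx) ↔ X = ∅ := by
  refine ⟨fun h => Set.eq_empty_of_forall_notMem fun s hs => h _ ⟨s, hs, rfl⟩, ?_⟩
  rintro rfl a ⟨s, hs, -⟩
  exact hs

end TeamLogic

theorem mainTheorem5 (L : FirstOrder.Language.{u, v}) :
    (∀ φ : TeamLogic.Formula L,
      φ.InLogic {TeamLogic.Constructor.dep, TeamLogic.Constructor.flat} →
      ∀ (n : ℕ) (x : Fin n → TeamLogic.Var),
        (φ.FV : Set TeamLogic.Var) ⊆ Set.range x →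
        ∃ θ : TeamLogic.ESOFormula L n,
          TeamLogic.ESOFormula.DownwardsClosed.{u, v, w} θ ∧
          ∀ (M : Type w) [L.Structure M] [Nonempty M] (D : Set TeamLogic.Var)
            (hx : ∀ i, x i ∈ D) (X : Set (D → M)),
            TeamLogic.Sat M φ D X ↔
              (TeamLogic.ESOFormula.Realize θ M (TeamLogic.teamRel X x hx) ∨
                ∀ a : Fin n → M, a ∉ TeamLogic.teamRel X x hx)) ∧
    TeamLogic.SameExpressivePower.{u, v, w} L
      {TeamLogic.Constructor.dep, TeamLogic.Constructor.flat} {TeamLogic.Constructor.dep} ∧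
    TeamLogic.SameExpressivePower.{u, v, w} L
      {TeamLogic.Constructor.excl, TeamLogic.Constructor.flat} {TeamLogic.Constructor.excl} := by
  refine ⟨fun φ hφ n x hx => ?_, TeamLogic.sameExpressivePower_flat L (by simp) ?_,
    TeamLogic.sameExpressivePower_flat L (by simp) ?_⟩
  · have hψ : φ.unflat.InLogic {.dep, .excl} := hφ.unflat (by
      rintro _ (rfl | rfl)
      exacts [Or.inr (Or.inl rfl), Or.inl rfl])
    obtain ⟨θ, hθ, h⟩ := TeamLogic.exists_esoFormula.{u, v, w} hψ
      ((Finset.coe_subset.2 φ.FV_unflat_subset).trans hx)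
    refine ⟨θ, hθ, fun M _ _ D hD X => ?_⟩
    -- The second disjunct holds only for the empty team, even when `n = 0`, so the first already
    -- absorbs it.
    rw [← TeamLogic.sat_unflat_iff, ← h M D hD X, TeamLogic.teamRel_eq_empty_iff, iff_self_or]
    rintro rfl
    exact TeamLogic.sat_empty _ D
  · rw [Set.pair_comm]
  · rw [Set.pair_comm]
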